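/- Let $m\ge 1$ and $k\ge 0$ be integers, let $|\cdot|$ be the Euclidean norm and $\mathbb S^m$ the unit sphere of $\mathbb R^{m+1}$, and let $\mathcal H^m$ be $m$-dimensional Hausdorff measure. For $g\in C^k(\mathbb R^{m+1}\setminus\{0\})$ put $$\rho_k(g):=\max\{|D^\alpha g(\xi)|:\xi\in\mathbb S^m,\ |\alpha|\le k\},\qquad \hat\rho_k(g):=\max\{1,\rho_k(g)\}.$$ There is a function $C=C(m,k,\cdot,\cdot)$, depending only on $m$ and $k$, with the following property. Let $F:\mathbb R^{m+1}\times\mathbb R^{m+1}\to\mathbb R$ and $x\in\mathbb R^{m+1}$ be such that $F(x,\cdot)$ is of class $C^k$ on $\mathbb R^{m+1}\setminus\{0\}$, $F(x,y)>0$ for all $y\neq 0$, and $F(x,ty)=tF(x,y)$ for all $t>0$ and $y\in\mathbb R^{m+1}$ (for instance, $F$ any Finsler metric on $\mathbb R^{m+1}$). Let $c_1(x):=\inf_{\mathbb S^m}F(x,\cdot)$, let $c_2(x)$ be any number with $F(x,y)\le c_2(x)|y|$ for all $y\in\mathbb R^{m+1}$ (for instance $c_2(x)=\sup_{\mathbb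 S^m}F(x,\cdot)$), and put $m_2(x):=c_2(x)^m$. Define the Finsler-area integrand by $$\mathcal A^F(x,Z):=\frac{|Z|\,\mathcal H^m(\{v\in\mathbb R^m:|v|<1\})}{\mathcal H^m(\{T\in\mathbb R^{m+1}:T\cdot Z=0,\ F(x,T)\le 1\})}\qquad (Z\neq 0),\qquad \mathcal A^F(x,0):=0.$$ Then $\mathcal A^F(x,\cdot)$ is of class $C^k$ on $\mathbb R^{m+1}\setminus\{0\}$, and $$\rho_k\big(|\cdot|-\mathcal A^F(x,\cdot)\big)\le C\big(m,k,m_2(x),c_1(x)\big)\,\rho_k\big(|\cdot|-F(x,\cdot)\big)\,\hat\rho_k\big(F(x,\cdot)\big)^{2k^2+mk-1}.$$ -/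

import Mathlib

open MeasureTheory

/-- The semi-norm `ρ_k(g) = max {|D^α g(ξ)| : ξ ∈ S^{n-1}, |α| ≤ k}` of a function `g` that is
of class `C^k` on `ℝⁿ \ {0}`. The partial derivative `∂_{σ 0} ⋯ ∂_{σ (j-1)} g (ξ)` is the `j`-th
derivative of `g` at `ξ` evaluated at the standard basis vectors `e_{σ 0}, …, e_{σ (j-1)}`; as
`j ≤ k` and `σ` vary these are exactly the derivatives `D^α g` with `|α| ≤ k`. By compactness of
the sphere the supremum is finite and attained for such `g`. -/
noncomputable def rho {n : ℕ} (k : ℕ) (g : EuclideanSpace ℝ (Fin n) → ℝ) : ℝ :=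
  sSup {r : ℝ | ∃ ξ ∈ Metric.sphere (0 : EuclideanSpace ℝ (Fin n)) 1,
    ∃ j ≤ k, ∃ σ : Fin j → Fin n,
      r = |iteratedFDeriv ℝ j g ξ (fun i => EuclideanSpace.single (σ i) (1 : ℝ))|}

/-- `ρ̂_k(g) = max {1, ρ_k(g)}`. -/
noncomputable def rhoHat {n : ℕ} (k : ℕ) (g : EuclideanSpace ℝ (Fin n) → ℝ) : ℝ :=
  max 1 (rho k g)

/-- The Finsler-area (Cartan) integrand
`A^F(x,Z) = |Z| H^m(B_1^m(0)) / H^m({T ∈ Z^⊥ ⊂ ℝ^{m+1} : F(x,T) ≤ 1})`, where `H^m` is the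
`m`-dimensional Hausdorff measure (normalised to agree with Lebesgue measure on `ℝ^m`).
At `Z = 0` the formula gives the value `0`. -/
noncomputable def finslerAreaIntegrand {m : ℕ}
    (F : EuclideanSpace ℝ (Fin (m + 1)) → EuclideanSpace ℝ (Fin (m + 1)) → ℝ)
    (x Z : EuclideanSpace ℝ (Fin (m + 1))) : ℝ :=
  ‖Z‖ * (μHE[m] : Measure (EuclideanSpace ℝ (Fin m))).real (Metric.ball 0 1) /
    (μHE[m] : Measure (EuclideanSpace ℝ (Fin (m + 1)))).real
      {T | inner ℝ T Z = 0 ∧ F x T ≤ 1}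

open Set Filter Topology

/-! Fix a unit vector `ξ` and work on the half-space of `Z` with positive inner product with `ξ`.
There `v ↦ tilt hξ v Z` parametrizes `Zᗮ` linearly in `v`, while for fixed `v` it is linear in `Z`.
In polar coordinates the area of `{G ≤ 1}` in `Zᗮ` becomes a Jacobian factor times `tiltIntegral hξ
G Z`, the integral of `G ^ (-m)` over a fixed sphere. The factor does not depend on `G`, so it
cancels in the quotient (`finslerAreaIntegrand_eq`). With `J_G` for these integrals and `E` for the
Euclidean norm, `|Z| - A^F = |Z| (J_F - J_E) / J_F`.

Smoothness follows by differentiating under the integral. For the estimate, `HasGradedBound` allows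
one factor `R` per derivative; products, reciprocals, powers, linear substitutions and integrals
preserve this form. Starting from `1/F - 1/E = (E - F) / (F E)`, the smallness of `E - F` passes
linearly to `J_F - J_E`. With `R = rhoHat k (F x)` the resulting bound is of order `R ^ k`, which
the stated power dominates when `k ≥ 1`; for `k = 0` the exponent is `-1`, and `R` itself is bounded
in terms of `c₂ ^ m`. -/

/-! ### Differentiation of parametric integrals over a compact space -/

/-- A compact neighbourhood times the compact space `X` is compact. The resulting bound is the
dominating constant in every use of dominated convergence below. -/
lemma exists_nhds_bound_of_continuousOn_prod_univ
    {E : Type*} [NormedAddCommGroup E] [NormedSpace ℝ E] [FiniteDimensional ℝ E]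
    {X : Type*} [TopologicalSpace X] [CompactSpace X]
    {G : Type*} [NormedAddCommGroup G]
    {U : Set E} (hU : IsOpen U) {q : E → X → G}
    (hq : ContinuousOn (fun z : E × X => q z.1 z.2) (U ×ˢ univ)) {p : E} (hp : p ∈ U) :
    ∃ s ∈ 𝓝 p, s ⊆ U ∧ ∃ B : ℝ, ∀ z ∈ s, ∀ x, ‖q z x‖ ≤ B := by
  have : ProperSpace E := FiniteDimensional.proper ℝ E
  obtain ⟨s, hs, hsU, hsc⟩ := local_compact_nhds (hU.mem_nhds hp)
  obtain ⟨B, hB⟩ := (hsc.prod isCompact_univ).exists_bound_of_continuousOn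
    (hq.mono (prod_mono_left hsU))
  exact ⟨s, hs, hsU, B, fun z hz x => hB (z, x) ⟨hz, mem_univ x⟩⟩

/-- Differentiation under the integral sign, to order `k`, over a compact parameter space. -/
lemma hasFTaylorSeriesUpToOn_integral
    {E : Type*} [NormedAddCommGroup E] [NormedSpace ℝ E] [FiniteDimensional ℝ E]
    {X : Type*} [TopologicalSpace X] [CompactSpace X] [SecondCountableTopology X]
    [MeasurableSpace X] [OpensMeasurableSpace X]
    {k : ℕ} {μ : Measure X} [IsFiniteMeasure μ] {U : Set E}
    (hU : IsOpen U) {f : E → X → ℝ} (hf : ∀ x, ContDiffOn ℝ k (fun z => f z x) U)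
    (hc : ∀ j ≤ k, ContinuousOn
      (fun z : E × X => iteratedFDerivWithin ℝ j (fun y => f y z.2) U z.1) (U ×ˢ univ)) :
    HasFTaylorSeriesUpToOn k (fun z => ∫ x, f z x ∂μ)
      (fun z j => ∫ x, iteratedFDerivWithin ℝ j (fun y => f y x) U z ∂μ) U := by
  have meas : ∀ j ≤ k, ∀ z ∈ U, Continuous
      (fun x => iteratedFDerivWithin ℝ j (fun y => f y x) U z) := fun j hj z hz =>
    (hc j hj).comp_continuous (f := fun x => (z, x)) (by fun_prop) (fun x => ⟨hz, mem_univ x⟩)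
  have integ : ∀ j ≤ k, ∀ z ∈ U, Integrable
      (fun x => iteratedFDerivWithin ℝ j (fun y => f y x) U z) μ := fun j hj z hz => by
    obtain ⟨s, hs, -, B, hB⟩ := exists_nhds_bound_of_continuousOn_prod_univ hU
      (q := fun z x => iteratedFDerivWithin ℝ j (fun y => f y x) U z) (hc j hj) hz
    exact Integrable.of_bound (meas j hj z hz).aestronglyMeasurable B
      (Eventually.of_forall fun x => hB z (mem_of_mem_nhds hs) x)
  refine ⟨fun z hz => ?_, fun j hj z hz => ?_, fun j hj z hz => ?_⟩
  · rw [ContinuousMultilinearMap.curry0]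
    rw [ContinuousMultilinearMap.integral_apply (integ 0 (Nat.zero_le _) z hz)]
    simp
  · have hj' : j + 1 ≤ k := by exact_mod_cast hj
    let L := (continuousMultilinearCurryLeftEquiv ℝ (fun _ : Fin (j + 1) => E) ℝ)
    have hcurry : (∫ x, iteratedFDerivWithin ℝ (j + 1) (fun y => f y x) U z ∂μ).curryLeft
        = ∫ x, (iteratedFDerivWithin ℝ (j + 1) (fun y => f y x) U z).curryLeft ∂μ := by
      let Lc : (E [×(j + 1)]→L[ℝ] ℝ) →L[ℝ] (E →L[ℝ] E [×j]→L[ℝ] ℝ) :=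
        L.toContinuousLinearEquiv.toContinuousLinearMap
      have := ContinuousLinearMap.integral_comp_comm (𝕜 := ℝ)
        (E := E [×(j + 1)]→L[ℝ] ℝ) (Fₗ := E →L[ℝ] E [×j]→L[ℝ] ℝ) Lc (integ (j + 1) hj' z hz)
      exact this.symm
    obtain ⟨s, hs, hsU, B, hB⟩ :=
      exists_nhds_bound_of_continuousOn_prod_univ hU
        (q := fun z x => iteratedFDerivWithin ℝ (j + 1) (fun y => f y x) U z) (hc (j + 1) hj') hz
    have hd : ∀ y ∈ U, ∀ x, HasFDerivAt (fun y' => iteratedFDerivWithin ℝ j (fun y => f y x) U y')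
        (iteratedFDerivWithin ℝ (j + 1) (fun y => f y x) U y).curryLeft y := fun y hy x =>
      (((hf x).ftaylorSeriesWithin hU.uniqueDiffOn).fderivWithin j hj y hy).hasFDerivAt
        (hU.mem_nhds hy)
    show HasFDerivWithinAt _ (∫ x, iteratedFDerivWithin ℝ (j + 1) (fun y => f y x) U z ∂μ).curryLeft
      U z
    rw [hcurry]
    refine (hasFDerivAt_integral_of_dominated_of_fderiv_le
      (F := fun z x => iteratedFDerivWithin ℝ j (fun y => f y x) U z)
      (F' := fun z x => (iteratedFDerivWithin ℝ (j + 1) (fun y => f y x) U z).curryLeft)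
      (bound := fun _ => B) hs ?_
      (integ j (by omega) z hz) ?_ ?_ (integrable_const B) ?_).hasFDerivWithinAt
    · filter_upwards [hU.mem_nhds hz] with y hy
      exact (meas j (by omega) y hy).aestronglyMeasurable
    · exact (L.continuous.comp (meas (j + 1) hj' z hz)).aestronglyMeasurable
    · refine Eventually.of_forall fun x y hy => ?_
      rw [ContinuousMultilinearMap.curryLeft_norm]
      exact hB y hy x
    · exact Eventually.of_forall fun x y hy => hd y (hsU hy) x
  · have hj' : j ≤ k := by exact_mod_cast hj
    obtain ⟨s, hs, hsU, B, hB⟩ := exists_nhds_bound_of_continuousOn_prod_univ hU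
      (q := fun z x => iteratedFDerivWithin ℝ j (fun y => f y x) U z) (hc j hj') hz
    refine (continuousAt_of_dominated (bound := fun _ => B) ?_ ?_ (integrable_const B)
      ?_).continuousWithinAt
    · filter_upwards [hU.mem_nhds hz] with y hy
      exact (meas j hj' y hy).aestronglyMeasurable
    · filter_upwards [hs] with y hy
      exact Eventually.of_forall fun x => hB y hy x
    · refine Eventually.of_forall fun x => ?_
      exact ((hf x).continuousOn_iteratedFDerivWithin hj hU.uniqueDiffOn).continuousAt
        (hU.mem_nhds hz)

/-- The slice is `g` composed with the affine map `y ↦ (y, v)`, whose linear part is `inl`; joint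
continuity of the slice derivatives is read off from this formula. -/
lemma iteratedFDerivWithin_slice
    {E : Type*} [NormedAddCommGroup E] [NormedSpace ℝ E]
    {V : Type*} [NormedAddCommGroup V] [NormedSpace ℝ V]
    {k : ℕ} {O : Set (E × V)} (hO : IsOpen O) {g : E × V → ℝ}
    (hg : ContDiffOn ℝ k g O) {U : Set E} (hU : IsOpen U) {v : V} (hv : ∀ z ∈ U, (z, v) ∈ O)
    {j : ℕ} (hj : j ≤ k) {z : E} (hz : z ∈ U) :
    iteratedFDerivWithin ℝ j (fun y => g (y, v)) U z =
      (iteratedFDerivWithin ℝ j g O (z, v)).compContinuousLinearMap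
        (fun _ => ContinuousLinearMap.inl ℝ E V) := by
  let A : E →ᴬ[ℝ] E × V := (ContinuousLinearMap.inl ℝ E V).toContinuousAffineMap
    + ContinuousAffineMap.const ℝ E ((0, v) : E × V)
  have hA : ∀ y, A y = (y, v) := fun y => by simp [A]
  have h := ((hg.ftaylorSeriesWithin hO.uniqueDiffOn).comp_continuousAffineMap A).mono
    (t := U) (fun y hy => by rw [mem_preimage, hA]; exact hv y hy)
  have h2 := h.eq_iteratedFDerivWithin_of_uniqueDiffOn (m := j) (by exact_mod_cast hj)
    hU.uniqueDiffOn hz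
  have hAl : A.contLinear = ContinuousLinearMap.inl ℝ E V := by
    ext <;> simp [A]
  simp only [hA, hAl] at h2
  rw [show (fun y => g (y, v)) = g ∘ A from funext fun y => by simp [hA]]
  exact h2.symm

lemma continuousOn_iteratedFDerivWithin_slice
    {E : Type*} [NormedAddCommGroup E] [NormedSpace ℝ E]
    {V : Type*} [NormedAddCommGroup V] [NormedSpace ℝ V]
    {X : Type*} [TopologicalSpace X]
    {k : ℕ} {O : Set (E × V)} (hO : IsOpen O)
    {g : E × V → ℝ} (hg : ContDiffOn ℝ k g O) {U : Set E} (hU : IsOpen U) {φ : X → V}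
    (hφ : Continuous φ) (hUO : ∀ z ∈ U, ∀ x, (z, φ x) ∈ O) {j : ℕ} (hj : j ≤ k) :
    ContinuousOn (fun z : E × X => iteratedFDerivWithin ℝ j (fun y => g (y, φ z.2)) U z.1)
      (U ×ˢ univ) := by
  have h1 : ContinuousOn (fun z : E × X => iteratedFDerivWithin ℝ j g O (z.1, φ z.2))
      (U ×ˢ univ) :=
    (hg.continuousOn_iteratedFDerivWithin (by exact_mod_cast hj) hO.uniqueDiffOn).comp
      (Continuous.continuousOn (by fun_prop)) (fun z hz => hUO z.1 hz.1 z.2)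
  refine (((ContinuousMultilinearMap.compContinuousLinearMapL
    (fun _ : Fin j => ContinuousLinearMap.inl ℝ E V)).continuous.comp_continuousOn h1)).congr
    fun z hz => ?_
  rw [iteratedFDerivWithin_slice hO hg hU (fun y hy => hUO y hy z.2) hj hz.1]
  rfl

/-- Parametric integrals over a compact space of a jointly `C^k` integrand are `C^k`, and their
derivatives are bounded by the supremum of the derivatives of the integrand. -/
lemma contDiffOn_integral_of_contDiffOn
    {E : Type*} [NormedAddCommGroup E] [NormedSpace ℝ E] [FiniteDimensional ℝ E]
    {V : Type*} [NormedAddCommGroup V] [NormedSpace ℝ V]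
    {X : Type*} [TopologicalSpace X] [CompactSpace X] [SecondCountableTopology X]
    [MeasurableSpace X] [OpensMeasurableSpace X]
    {k : ℕ} {μ : Measure X} [IsFiniteMeasure μ]
    {O : Set (E × V)} (hO : IsOpen O) {g : E × V → ℝ} (hg : ContDiffOn ℝ k g O) {U : Set E}
    (hU : IsOpen U) {φ : X → V} (hφ : Continuous φ) (hUO : ∀ z ∈ U, ∀ x, (z, φ x) ∈ O) :
    ContDiffOn ℝ k (fun z => ∫ x, g (z, φ x) ∂μ) U ∧
    ∀ j ≤ k, ∀ z ∈ U, ∀ B : ℝ,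
      (∀ x, ‖iteratedFDerivWithin ℝ j (fun y => g (y, φ x)) U z‖ ≤ B) →
      ‖iteratedFDerivWithin ℝ j (fun y => ∫ x, g (y, φ x) ∂μ) U z‖ ≤ B * μ.real univ := by
  have h := hasFTaylorSeriesUpToOn_integral (μ := μ) (k := k) hU (f := fun z x => g (z, φ x))
    (fun x => hg.comp (t := O) (f := fun z : E => (z, φ x)) (by fun_prop) (fun z hz => hUO z hz x))
    (fun j hj => continuousOn_iteratedFDerivWithin_slice hO hg hU hφ hUO hj)
  refine ⟨h.contDiffOn, fun j hj z hz B hB => ?_⟩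
  rw [← h.eq_iteratedFDerivWithin_of_uniqueDiffOn (by exact_mod_cast hj) hU.uniqueDiffOn hz]
  exact norm_integral_le_of_norm_le_const (Eventually.of_forall hB)

/-! ### Calculus of graded derivative bounds -/

/-- `f` is `C^k` on `U` and its `j`-th derivative at `p` is bounded by `C * R ^ j` for `j ≤ k`. -/
def HasGradedBound {E : Type*} [NormedAddCommGroup E] [NormedSpace ℝ E] (k : ℕ) (U : Set E) (p : E)
    (R C : ℝ) (f : E → ℝ) : Prop :=
  ContDiffOn ℝ k f U ∧ ∀ j ≤ k, ‖iteratedFDerivWithin ℝ j f U p‖ ≤ C * R ^ j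

namespace HasGradedBound

variable {E : Type*} [NormedAddCommGroup E] [NormedSpace ℝ E] {k : ℕ} {U : Set E} {p : E}
  {R C D : ℝ} {f g : E → ℝ}

lemma nonneg (hf : HasGradedBound k U p R C f) : 0 ≤ C := by
  have := (norm_nonneg _).trans (hf.2 0 (Nat.zero_le _))
  simpa using this

lemma mono (hf : HasGradedBound k U p R C f) (hR : 0 ≤ R) (h : C ≤ D) :
    HasGradedBound k U p R D f :=
  ⟨hf.1, fun j hj => (hf.2 j hj).trans (by gcongr)⟩

lemma congr (hf : HasGradedBound k U p R C f) (h : EqOn g f U) (hp : p ∈ U) :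
    HasGradedBound k U p R C g :=
  ⟨hf.1.congr h, fun j hj => by rw [iteratedFDerivWithin_congr h hp]; exact hf.2 j hj⟩

lemma add (hf : HasGradedBound k U p R C f) (hg : HasGradedBound k U p R D g) (hU : IsOpen U)
    (hp : p ∈ U) : HasGradedBound k U p R (C + D) (fun z => f z + g z) := by
  refine ⟨hf.1.add hg.1, fun j hj => ?_⟩
  have hj' : (j : WithTop ℕ∞) ≤ k := by exact_mod_cast hj
  rw [fun_iteratedFDerivWithin_add_apply ((hf.1.of_le hj') p hp) ((hg.1.of_le hj') p hp)
    hU.uniqueDiffOn hp, add_mul]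
  exact (norm_add_le _ _).trans (add_le_add (hf.2 j hj) (hg.2 j hj))

lemma mul (hf : HasGradedBound k U p R C f) (hg : HasGradedBound k U p R D g) (hU : IsOpen U)
    (hp : p ∈ U) (hR : 0 ≤ R) : HasGradedBound k U p R (2 ^ k * (C * D)) (fun z => f z * g z) := by
  refine ⟨hf.1.mul hg.1, fun j hj => ?_⟩
  refine (norm_iteratedFDerivWithin_mul_le hf.1 hg.1 hU.uniqueDiffOn hp
    (by exact_mod_cast hj)).trans ?_
  have hC := hf.nonneg
  have hD := hg.nonneg
  calc _ ≤ ∑ i ∈ Finset.range (j + 1), (j.choose i : ℝ) * (C * D * R ^ j) := by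
        refine Finset.sum_le_sum fun i hi => ?_
        have hi' : i ≤ j := Nat.lt_succ_iff.1 (Finset.mem_range.1 hi)
        rw [mul_assoc]
        refine mul_le_mul_of_nonneg_left ?_ (Nat.cast_nonneg _)
        calc _ ≤ (C * R ^ i) * (D * R ^ (j - i)) :=
              mul_le_mul (hf.2 i (hi'.trans hj)) (hg.2 _ ((Nat.sub_le _ _).trans hj))
                (norm_nonneg _) (by positivity)
          _ = C * D * (R ^ i * R ^ (j - i)) := by ring
          _ = C * D * R ^ j := by rw [← pow_add, Nat.add_sub_cancel' hi']
    _ = 2 ^ j * (C * D * R ^ j) := by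
        rw [← Finset.sum_mul, ← Nat.cast_sum, Nat.sum_range_choose]; norm_num
    _ ≤ 2 ^ k * (C * D) * R ^ j := by
        rw [← mul_assoc]
        gcongr
        norm_num

lemma const (c : ℝ) (hU : IsOpen U) (hp : p ∈ U) (hR : 0 ≤ R) :
    HasGradedBound k U p R |c| (fun _ => c) := by
  refine ⟨contDiffOn_const, fun j hj => ?_⟩
  rcases Nat.eq_zero_or_pos j with rfl | h
  · simp
  · rw [iteratedFDerivWithin_of_isOpen _ hU hp, iteratedFDeriv_const_of_ne h.ne']
    simp only [Pi.zero_apply, norm_zero]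
    positivity

lemma pow (hf : HasGradedBound k U p R C f) (hU : IsOpen U) (hp : p ∈ U) (hR : 0 ≤ R) (n : ℕ) :
    HasGradedBound k U p R ((2 ^ k * C) ^ n) (fun z => f z ^ n) := by
  induction n with
  | zero => simpa using const (k := k) (R := R) (1 : ℝ) hU hp hR
  | succ n ih =>
    have h := ih.mul hf hU hp hR
    simp only [pow_succ]
    refine h.mono hR (le_of_eq ?_)
    ring

lemma norm_iteratedFDeriv_inv_le {a r : ℝ} (ha : 0 < a) (har : a ≤ |r|) {i : ℕ} (hi : i ≤ k) :
    ‖iteratedFDeriv ℝ i (fun x : ℝ => x⁻¹) r‖ ≤ k.factorial * (max 1 a⁻¹) ^ (k + 1) := by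
  have hr : 0 < |r| := ha.trans_le har
  rw [norm_iteratedFDeriv_eq_norm_iteratedDeriv, iteratedDeriv_eq_iterate, iter_deriv_inv]
  have h1 : ‖(-1 : ℝ) ^ i * (i.factorial : ℝ)‖ = i.factorial := by simp
  rw [norm_mul]
  have h2 : ‖r ^ (-1 - (i : ℤ))‖ ≤ (max 1 a⁻¹) ^ (k + 1) := by
    rw [norm_zpow, Real.norm_eq_abs, show (-1 - (i : ℤ)) = -((i + 1 : ℕ) : ℤ) by push_cast; ring,
      zpow_neg, zpow_natCast, ← inv_pow]
    calc |r|⁻¹ ^ (i + 1) ≤ (max 1 a⁻¹) ^ (i + 1) := by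
          gcongr
          exact (inv_anti₀ ha har).trans (le_max_right _ _)
      _ ≤ _ := pow_le_pow_right₀ (le_max_left _ _) (by omega)
  rw [h1]
  have h3 : (i.factorial : ℝ) ≤ k.factorial := by exact_mod_cast Nat.factorial_le hi
  gcongr

/-- The graded bound of the inverse of a function with graded bound `C` that is at least `a`. -/
noncomputable def invBound (k : ℕ) (a C : ℝ) : ℝ :=
  k.factorial * (k.factorial * (max 1 a⁻¹) ^ (k + 1)) * (max 1 C) ^ k

lemma inv (hf : HasGradedBound k U p R C f) (hU : IsOpen U) (hp : p ∈ U) (hR : 1 ≤ R)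
    (h0 : ∀ z ∈ U, f z ≠ 0) {a : ℝ} (ha : 0 < a) (hap : a ≤ |f p|) :
    HasGradedBound k U p R (invBound k a C) (fun z => (f z)⁻¹) := by
  refine ⟨hf.1.inv h0, fun j hj => ?_⟩
  have hC : (0 : ℝ) ≤ k.factorial * (max 1 a⁻¹) ^ (k + 1) := by positivity
  have hm : (1 : ℝ) ≤ max 1 C := le_max_left _ _
  -- The composition bound asks for inner derivatives of order `i ≥ 1` to be at most `D ^ i`. The
  -- choice `D = max 1 C * R` meets this and leaves exactly `R ^ j` at order `j`.
  have h := norm_iteratedFDerivWithin_comp_le (n := j) (N := k) (g := fun x : ℝ => x⁻¹)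
    (t := {0}ᶜ) (s := U) (f := f) (x := p) (C := k.factorial * (max 1 a⁻¹) ^ (k + 1))
    (D := max 1 C * R) (contDiffOn_id.inv (fun x hx => hx)) hf.1
    (by exact_mod_cast hj) isOpen_compl_singleton.uniqueDiffOn hU.uniqueDiffOn
    (fun z hz => h0 z hz) hp
    (fun i hi => by
      rw [iteratedFDerivWithin_of_isOpen _ isOpen_compl_singleton (h0 p hp)]
      exact norm_iteratedFDeriv_inv_le ha hap (hi.trans hj))
    (fun i hi hij => by
      rw [mul_pow]
      refine (hf.2 i (hij.trans hj)).trans ?_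
      gcongr
      exact (le_max_right 1 C).trans (le_self_pow₀ hm (by omega)))
  refine h.trans ?_
  rw [invBound, mul_pow, ← mul_assoc]
  gcongr

/-- The difference of powers inherits the small bound of the difference. -/
lemma exists_pow_sub (k : ℕ) (A B : ℝ) (n : ℕ) : ∃ Q : ℝ, 0 ≤ Q ∧
    ∀ {E : Type} [NormedAddCommGroup E] [NormedSpace ℝ E] {U : Set E} {p : E}
      {R D : ℝ} {f g : E → ℝ}, IsOpen U → p ∈ U → 0 ≤ R →
      HasGradedBound k U p R A f → HasGradedBound k U p R B g →
      HasGradedBound k U p R D (fun z => f z - g z) →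
      HasGradedBound k U p R (Q * D) (fun z => f z ^ n - g z ^ n) := by
  induction n with
  | zero =>
    refine ⟨0, le_rfl, fun hU hp hR _ _ _ => ?_⟩
    simpa using const (k := k) 0 hU hp hR
  | succ n ih =>
    obtain ⟨Q, hQ, ih⟩ := ih
    refine ⟨2 ^ k * (|A| * Q) + 2 ^ k * |(2 ^ k * B) ^ n|, by positivity,
      fun hU hp hR hf hg hd => ?_⟩
    -- Telescoping: `f^(n+1) - g^(n+1) = f (f^n - g^n) + (f - g) g^n`, each term carrying one small
    -- factor.
    have h1 := (hf.mono hR (le_abs_self A)).mul (ih hU hp hR hf hg hd) hU hp hR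
    have h2 := hd.mul ((hg.pow hU hp hR n).mono hR (le_abs_self _)) hU hp hR
    refine ((h1.add h2 hU hp).congr (fun z _ => ?_) hp).mono hR (le_of_eq ?_)
    · ring
    · ring

/-- For a linear inner map the chain rule has a single term, costing one factor `‖h‖` per
derivative. -/
lemma of_comp_linear {W : Type*} [NormedAddCommGroup W] [NormedSpace ℝ W] {O : Set W}
    {F : W → ℝ} (hO : IsOpen O) (hF : ContDiffOn ℝ k F O) (h : E →L[ℝ] W) {b : ℝ} (hb : 1 ≤ b)
    (hnorm : ‖h‖ ≤ b) (hU : IsOpen U) (hp : p ∈ U) (hUO : MapsTo h U O) (hR : 0 ≤ R)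
    (hC : ∀ j ≤ k, ‖iteratedFDeriv ℝ j F (h p)‖ ≤ C * R ^ j) :
    HasGradedBound k U p R (b ^ k * C) (fun z => F (h z)) := by
  refine ⟨hF.comp h.contDiff.contDiffOn hUO, fun j hj => ?_⟩
  have hC0 : 0 ≤ C := by
    have := (norm_nonneg _).trans (hC 0 (Nat.zero_le _))
    simpa using this
  have hpre : IsOpen (h ⁻¹' O) := hO.preimage h.continuous
  have h1 := h.iteratedFDerivWithin_comp_right hF hO.uniqueDiffOn hpre.uniqueDiffOn (hUO hp)
    (i := j) (by exact_mod_cast hj)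
  rw [iteratedFDerivWithin_of_isOpen _ hU hp]
  rw [iteratedFDerivWithin_of_isOpen _ hpre (hUO hp), iteratedFDerivWithin_of_isOpen _ hO (hUO hp)]
    at h1
  rw [show (fun z => F (h z)) = F ∘ h from rfl, h1]
  refine (ContinuousMultilinearMap.norm_compContinuousLinearMap_le _ _).trans ?_
  rw [Finset.prod_const, Finset.card_univ, Fintype.card_fin]
  have h2 : ‖h‖ ^ j ≤ b ^ k :=
    (pow_le_pow_left₀ (norm_nonneg _) hnorm j).trans (pow_le_pow_right₀ hb hj)
  calc _ ≤ C * R ^ j * b ^ k := by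
        gcongr
        exact hC j hj
    _ = _ := by ring

lemma integral {E : Type*} [NormedAddCommGroup E] [NormedSpace ℝ E] [FiniteDimensional ℝ E]
    {V : Type*} [NormedAddCommGroup V] [NormedSpace ℝ V]
    {X : Type*} [TopologicalSpace X] [CompactSpace X] [SecondCountableTopology X]
    [MeasurableSpace X] [OpensMeasurableSpace X] {μ : Measure X} [IsFiniteMeasure μ]
    {k : ℕ} {R C : ℝ} {O : Set (E × V)} (hO : IsOpen O) {g : E × V → ℝ} (hg : ContDiffOn ℝ k g O)
    {U : Set E} {p : E} (hU : IsOpen U) (hp : p ∈ U) {φ : X → V} (hφ : Continuous φ)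
    (hUO : ∀ z ∈ U, ∀ x, (z, φ x) ∈ O)
    (h : ∀ x, HasGradedBound k U p R C (fun z => g (z, φ x))) :
    HasGradedBound k U p R (C * μ.real univ) (fun z => ∫ x, g (z, φ x) ∂μ) := by
  obtain ⟨h1, h2⟩ := contDiffOn_integral_of_contDiffOn (μ := μ) hO hg hU hφ hUO
  refine ⟨h1, fun j hj => (h2 j hj p hp _ fun x => (h x).2 j hj).trans (le_of_eq ?_)⟩
  ring

end HasGradedBound

/-! ### Sublevel sets in polar coordinates -/

lemma volumeIoiPow_singleton (n : ℕ) (x : Ioi (0 : ℝ)) : Measure.volumeIoiPow n {x} = 0 := by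
  refine withDensity_absolutelyContinuous _ _ ?_
  rw [comap_subtype_coe_apply measurableSet_Ioi]
  simp

lemma volumeIoiPow_Iic (n : ℕ) (x : Ioi (0 : ℝ)) :
    Measure.volumeIoiPow n (Iic x) = ENNReal.ofReal (x.1 ^ (n + 1) / (n + 1)) := by
  rw [← Measure.volumeIoiPow_apply_Iio, ← Iio_union_right]
  refine le_antisymm ((measure_union_le _ _).trans ?_) (measure_mono subset_union_left)
  rw [volumeIoiPow_singleton, add_zero]

/-- Volume of the unit sublevel set of a positively homogeneous function in polar coordinates. -/
lemma measureReal_sublevel_of_homogeneous {V : Type*} [NormedAddCommGroup V] [NormedSpace ℝ V]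
    [FiniteDimensional ℝ V] [Nontrivial V] [MeasurableSpace V] [BorelSpace V] (μ : Measure V)
    [μ.IsAddHaarMeasure] {G : V → ℝ} (hc : ContinuousOn G {0}ᶜ) (hpos : ∀ v, v ≠ 0 → 0 < G v)
    (hhom : ∀ (t : ℝ) (v : V), 0 < t → G (t • v) = t * G v) :
    μ.real {v | G v ≤ 1} =
      (∫ θ : Metric.sphere (0 : V) 1, ((G θ)⁻¹) ^ Module.finrank ℝ V ∂μ.toSphere) /
        Module.finrank ℝ V := by
  set d := Module.finrank ℝ V with hd
  have hd0 : 0 < d := Module.finrank_pos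
  have hne : ∀ θ : Metric.sphere (0 : V) 1, (θ : V) ≠ 0 := fun θ => ne_zero_of_mem_unit_sphere θ
  have hGc : Continuous fun θ : Metric.sphere (0 : V) 1 => G θ :=
    hc.comp_continuous continuous_subtype_val hne
  have hGpos : ∀ θ : Metric.sphere (0 : V) 1, 0 < G θ := fun θ => hpos _ (hne θ)
  let T : Set (Metric.sphere (0 : V) 1 × Ioi (0 : ℝ)) := {q | q.2.1 * G q.1 ≤ 1}
  have hT : MeasurableSet T := by
    refine IsClosed.measurableSet (isClosed_le ?_ continuous_const)
    exact (continuous_subtype_val.comp continuous_snd).mul (hGc.comp continuous_fst)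
  have h1 : μ {v | G v ≤ 1} = (μ.toSphere.prod (Measure.volumeIoiPow (d - 1))) T := by
    rw [← (μ.measurePreserving_homeomorphUnitSphereProd).measure_preimage hT.nullMeasurableSet,
      comap_subtype_coe_apply (measurableSet_singleton _).compl]
    refine measure_congr ?_
    -- Polar coordinates miss the origin, which is a null set.
    have h0 : ∀ᵐ v ∂μ, v ≠ 0 := by
      rw [ae_iff]; simp
    filter_upwards [h0] with v hv
    refine propext ?_
    have hn : 0 < ‖v‖ := norm_pos_iff.2 hv
    have hGv : G v = ‖v‖ * G (‖v‖⁻¹ • v) := by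
      rw [hhom _ _ (inv_pos.2 hn)]
      field_simp
    have key : ∀ w : ({0}ᶜ : Set V), w.1 = v →
        (w ∈ homeomorphUnitSphereProd V ⁻¹' T ↔ G v ≤ 1) := by
      rintro w rfl
      rw [hGv]
      simp [T, homeomorphUnitSphereProd]
    constructor
    · intro h
      exact ⟨⟨v, hv⟩, (key ⟨v, hv⟩ rfl).2 h, rfl⟩
    · rintro ⟨w, hw, hwv⟩
      exact (key w hwv).1 hw
  -- Along the ray through `θ` the sublevel set is `0 < r ≤ 1 / G θ`, of mass `(G θ)⁻¹ ^ d / d` for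
  -- `r ^ (d - 1) dr`.
  have h2 : ∀ θ : Metric.sphere (0 : V) 1, Measure.volumeIoiPow (d - 1) (Prod.mk θ ⁻¹' T) =
      ENNReal.ofReal (((G θ)⁻¹) ^ d / d) := fun θ => by
    have : Prod.mk θ ⁻¹' T = Iic ⟨(G θ)⁻¹, inv_pos.2 (hGpos θ)⟩ := by
      ext r
      simp only [T, mem_preimage, mem_ofPred_eq, mem_Iic, ← Subtype.coe_le_coe]
      rw [← le_div_iff₀ (hGpos θ), one_div]
    rw [this, volumeIoiPow_Iic, Nat.sub_add_cancel hd0]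
    congr 2
    rw [Nat.cast_sub hd0]; simp
  have hcont : Continuous fun θ : Metric.sphere (0 : V) 1 => ((G θ)⁻¹) ^ d / d :=
    ((hGc.inv₀ fun θ => (hGpos θ).ne').pow d).div_const _
  rw [measureReal_def, h1, Measure.prod_apply hT]
  simp_rw [h2]
  rw [← integral_div, integral_eq_lintegral_of_nonneg_ae
    (Eventually.of_forall fun θ => by have := hGpos θ; positivity) hcont.aestronglyMeasurable]

/-! ### Parametrizing hyperplanes and rewriting the area integrand -/

section Hyperplane

variable {m : ℕ}

local notation "𝔼" n => EuclideanSpace ℝ (Fin n)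

/-- A linear isometric parametrization of the hyperplane orthogonal to `Z`. -/
noncomputable def hyperplaneParam {Z : 𝔼 (m + 1)} (hZ : Z ≠ 0) : (𝔼 m) →ₗᵢ[ℝ] 𝔼 (m + 1) :=
  haveI : Fact (Module.finrank ℝ (𝔼 (m + 1)) = m + 1) := ⟨by simp⟩
  ((ℝ ∙ Z)ᗮ).subtypeₗᵢ.comp
    (OrthonormalBasis.fromOrthogonalSpanSingleton (𝕜 := ℝ) m hZ).repr.symm.toLinearIsometry

lemma range_hyperplaneParam {Z : 𝔼 (m + 1)} (hZ : Z ≠ 0) (T : 𝔼 (m + 1)) :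
    T ∈ range (hyperplaneParam hZ) ↔ inner ℝ T Z = 0 := by
  have : Fact (Module.finrank ℝ (𝔼 (m + 1)) = m + 1) := ⟨by simp⟩
  rw [← Submodule.mem_orthogonal_singleton_iff_inner_left]
  constructor
  · rintro ⟨v, rfl⟩
    exact ((OrthonormalBasis.fromOrthogonalSpanSingleton (𝕜 := ℝ) m hZ).repr.symm v).2
  · intro h
    refine ⟨(OrthonormalBasis.fromOrthogonalSpanSingleton (𝕜 := ℝ) m hZ).repr ⟨T, h⟩, ?_⟩
    simp [hyperplaneParam]

lemma inner_hyperplaneParam {Z : 𝔼 (m + 1)} (hZ : Z ≠ 0) (v : 𝔼 m) :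
    inner ℝ (hyperplaneParam hZ v) Z = 0 :=
  (range_hyperplaneParam hZ _).1 (mem_range_self v)

/-- This identifies the numerator of the area integrand with the denominator for the Euclidean norm.
-/
lemma measureReal_hyperplane_closedBall (hm : 1 ≤ m) {Z : 𝔼 (m + 1)} (hZ : Z ≠ 0) :
    (μHE[m] : Measure (𝔼 (m + 1))).real {T | inner ℝ T Z = 0 ∧ ‖T‖ ≤ 1} =
      (μHE[m] : Measure (𝔼 m)).real (Metric.ball 0 1) := by
  have : Nonempty (Fin m) := ⟨⟨0, hm⟩⟩
  have : {T : 𝔼 (m + 1) | inner ℝ T Z = 0 ∧ ‖T‖ ≤ 1} =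
      hyperplaneParam hZ '' Metric.closedBall 0 1 := by
    ext T
    constructor
    · rintro ⟨h1, h2⟩
      obtain ⟨v, rfl⟩ := (range_hyperplaneParam hZ T).2 h1
      exact ⟨v, by simpa using h2, rfl⟩
    · rintro ⟨v, hv, rfl⟩
      exact ⟨inner_hyperplaneParam hZ v, by simpa using hv⟩
  rw [this, measureReal_def, (hyperplaneParam hZ).isometry.euclideanHausdorffMeasure_image,
    EuclideanSpace.euclideanHausdorffMeasure_eq_volume, measureReal_def,
    Measure.addHaar_closedBall_eq_addHaar_ball]

/-- A linear parametrization of a hyperplane distorts the `m`-dimensional measure by a constant. -/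
lemma exists_measureReal_hyperplane_eq {Z : 𝔼 (m + 1)} (hZ : Z ≠ 0) (L : (𝔼 m) →ₗ[ℝ] 𝔼 (m + 1))
    (hL : Function.Injective L) (hLZ : ∀ v, inner ℝ (L v) Z = 0) :
    ∃ c : ℝ, ∀ G : (𝔼 (m + 1)) → ℝ,
      (μHE[m] : Measure (𝔼 (m + 1))).real {T | inner ℝ T Z = 0 ∧ G T ≤ 1} =
        c * volume.real {v | G (L v) ≤ 1} := by
  let P := hyperplaneParam hZ
  have hex : ∀ v, ∃ w, P w = L v := fun v => (range_hyperplaneParam hZ _).2 (hLZ v)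
  choose M₀ hM₀ using hex
  let M : (𝔼 m) →ₗ[ℝ] 𝔼 m :=
    { toFun := M₀
      map_add' := fun v w => P.injective (by simp [hM₀])
      map_smul' := fun t v => P.injective (by simp [hM₀]) }
  have hM : ∀ v, P (M v) = L v := hM₀
  have hMinj : Function.Injective M := fun v w h => hL (by rw [← hM, ← hM, h])
  have hMsurj : Function.Surjective M := LinearMap.injective_iff_surjective.1 hMinj
  -- `L` is the isometry `P` after `M`, so the distortion is the determinant of `M`, whatever `G`
  -- is.
  refine ⟨|LinearMap.det M|, fun G => ?_⟩
  have : {T : 𝔼 (m + 1) | inner ℝ T Z = 0 ∧ G T ≤ 1} = P '' (M '' {v | G (L v) ≤ 1}) := by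
    ext T
    constructor
    · rintro ⟨h1, h2⟩
      obtain ⟨w, rfl⟩ := (range_hyperplaneParam hZ T).2 h1
      obtain ⟨v, rfl⟩ := hMsurj w
      exact ⟨M v, ⟨v, by rw [mem_ofPred_eq, ← hM]; exact h2, rfl⟩, rfl⟩
    · rintro ⟨_, ⟨v, hv, rfl⟩, rfl⟩
      exact ⟨inner_hyperplaneParam hZ _, by rw [hM]; exact hv⟩
  rw [this, measureReal_def, P.isometry.euclideanHausdorffMeasure_image,
    EuclideanSpace.euclideanHausdorffMeasure_eq_volume, Measure.addHaar_image_linearMap,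
    ENNReal.toReal_mul, ENNReal.toReal_ofReal (abs_nonneg _), measureReal_def]

/-- For fixed `ξ` and `Z` a parametrization of `Zᗮ` in terms of `v`; linear in `Z`. -/
noncomputable def tilt {ξ : 𝔼 (m + 1)} (hξ : ξ ≠ 0) (v : 𝔼 m) : (𝔼 (m + 1)) →L[ℝ] 𝔼 (m + 1) :=
  (innerSL ℝ ξ).smulRight (hyperplaneParam hξ v) - (innerSL ℝ (hyperplaneParam hξ v)).smulRight ξ

variable {ξ : 𝔼 (m + 1)} (hξ : ξ ≠ 0)

lemma tilt_apply (v : 𝔼 m) (Z : 𝔼 (m + 1)) :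
    tilt hξ v Z = inner ℝ ξ Z • hyperplaneParam hξ v - inner ℝ (hyperplaneParam hξ v) Z • ξ := by
  simp [tilt]

lemma inner_tilt (v : 𝔼 m) (Z : 𝔼 (m + 1)) : inner ℝ (tilt hξ v Z) Z = 0 := by
  rw [tilt_apply, inner_sub_left, inner_smul_left, inner_smul_left]
  simp; ring

/-- At the base point the tilt is isometric in `v`, so estimates at `ξ` involve only values and
derivatives on the unit sphere. -/
lemma tilt_self (h1 : ‖ξ‖ = 1) (v : 𝔼 m) : tilt hξ v ξ = hyperplaneParam hξ v := by
  rw [tilt_apply, inner_hyperplaneParam, real_inner_self_eq_norm_sq, h1]; simp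

lemma norm_tilt_le (h1 : ‖ξ‖ = 1) (v : 𝔼 m) : ‖tilt hξ v‖ ≤ 2 * ‖v‖ := by
  refine (norm_sub_le _ _).trans ?_
  rw [ContinuousLinearMap.norm_smulRight_apply, ContinuousLinearMap.norm_smulRight_apply,
    innerSL_apply_norm, innerSL_apply_norm, h1, LinearIsometry.norm_map]
  linarith

lemma tilt_ne_zero {v : 𝔼 m} (hv : v ≠ 0) {Z : 𝔼 (m + 1)} (hZ : 0 < inner ℝ ξ Z) :
    tilt hξ v Z ≠ 0 := by
  intro h
  -- Pairing with `hyperplaneParam hξ v`, which is orthogonal to `ξ`, leaves `⟨ξ, Z⟩ ‖v‖²`.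
  have h2 : inner ℝ (tilt hξ v Z) (hyperplaneParam hξ v) = 0 := by rw [h, inner_zero_left]
  rw [tilt_apply, inner_sub_left, inner_smul_left, inner_smul_left,
    real_inner_comm (hyperplaneParam hξ v) ξ, inner_hyperplaneParam hξ, real_inner_self_eq_norm_sq,
    LinearIsometry.norm_map] at h2
  have : 0 < ‖v‖ := norm_pos_iff.2 hv
  simp [hZ.ne', this.ne'] at h2

/-- For fixed `Z` the map `v ↦ tilt hξ v Z` is linear. -/
noncomputable def tiltLinear (Z : 𝔼 (m + 1)) : (𝔼 m) →ₗ[ℝ] 𝔼 (m + 1) where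
  toFun v := tilt hξ v Z
  map_add' v w := by simp only [tilt_apply, map_add, inner_add_left]; module
  map_smul' t v := by simp only [tilt_apply, map_smul, inner_smul_left]; simp; module

/-- The spherical integral representing the area of the unit sublevel set in `Zᗮ`. -/
noncomputable def tiltIntegral (F : (𝔼 (m + 1)) → ℝ) (Z : 𝔼 (m + 1)) : ℝ :=
  ∫ θ : Metric.sphere (0 : 𝔼 m) 1, ((F (tilt hξ θ Z))⁻¹) ^ m ∂(volume : Measure (𝔼 m)).toSphere

/-- The constant is chosen before `G`: the same one serves `F x` and the norm, and no formula for it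
is needed. -/
lemma exists_measureReal_hyperplane_eq_tiltIntegral (hm : 1 ≤ m) {Z : 𝔼 (m + 1)}
    (hZ : 0 < inner ℝ ξ Z) :
    ∃ c : ℝ, ∀ G : (𝔼 (m + 1)) → ℝ, ContinuousOn G {0}ᶜ → (∀ y, y ≠ 0 → 0 < G y) →
      (∀ (t : ℝ) (y : 𝔼 (m + 1)), 0 < t → G (t • y) = t * G y) →
      (μHE[m] : Measure (𝔼 (m + 1))).real {T | inner ℝ T Z = 0 ∧ G T ≤ 1} =
        c * tiltIntegral hξ G Z := by
  have hZ0 : Z ≠ 0 := by rintro rfl; simp at hZ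
  have : Nonempty (Fin m) := ⟨⟨0, hm⟩⟩
  have hL0 : ∀ v, v ≠ 0 → tiltLinear hξ Z v ≠ 0 := fun v hv => tilt_ne_zero hξ hv hZ
  have hinj : Function.Injective (tiltLinear hξ Z) := by
    rw [injective_iff_map_eq_zero]
    intro v hv
    by_contra h
    exact hL0 v h hv
  obtain ⟨c, hc⟩ := exists_measureReal_hyperplane_eq hZ0 (tiltLinear hξ Z) hinj
    (fun v => inner_tilt hξ v Z)
  refine ⟨c / m, fun G h1 h2 h3 => ?_⟩
  rw [hc G, measureReal_sublevel_of_homogeneous volume (G := fun v => G (tiltLinear hξ Z v))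
    (h1.comp (tiltLinear hξ Z).continuous_of_finiteDimensional.continuousOn hL0)
    (fun v hv => h2 _ (hL0 v hv)) (fun t v ht => by simp only [map_smul]; exact h3 t _ ht)]
  simp only [finrank_euclideanSpace, Fintype.card_fin]
  rw [mul_div_assoc', div_mul_eq_mul_div]
  rfl

lemma toSphere_real_pos (hm : 1 ≤ m) : 0 < (volume : Measure (𝔼 m)).toSphere.real univ := by
  have : Nonempty (Fin m) := ⟨⟨0, hm⟩⟩
  rw [Measure.toSphere_real_apply_univ]
  refine mul_pos (by exact_mod_cast Module.finrank_pos) ?_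
  exact ENNReal.toReal_pos (Metric.measure_ball_pos _ _ one_pos).ne' measure_ball_lt_top.ne

lemma finslerAreaIntegrand_eq (hm : 1 ≤ m) {Z : 𝔼 (m + 1)} (hZ : 0 < inner ℝ ξ Z)
    {F : (𝔼 (m + 1)) → (𝔼 (m + 1)) → ℝ} {x : 𝔼 (m + 1)} (h1 : ContinuousOn (F x) {0}ᶜ)
    (h2 : ∀ y, y ≠ 0 → 0 < F x y)
    (h3 : ∀ (t : ℝ) (y : 𝔼 (m + 1)), 0 < t → F x (t • y) = t * F x y) :
    finslerAreaIntegrand F x Z =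
      ‖Z‖ * (tiltIntegral hξ (fun y => ‖y‖) Z * (tiltIntegral hξ (F x) Z)⁻¹) := by
  have hZ0 : Z ≠ 0 := by rintro rfl; simp at hZ
  obtain ⟨c, hc⟩ := exists_measureReal_hyperplane_eq_tiltIntegral hξ hm hZ
  have hE := hc (fun y => ‖y‖) continuous_norm.continuousOn (fun y hy => norm_pos_iff.2 hy)
    (fun t y ht => by rw [norm_smul, Real.norm_of_nonneg ht.le])
  rw [measureReal_hyperplane_closedBall hm hZ0] at hE
  have hb : (μHE[m] : Measure (𝔼 m)).real (Metric.ball 0 1) ≠ 0 := by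
    rw [EuclideanSpace.euclideanHausdorffMeasure_eq_volume]
    exact (ENNReal.toReal_pos (Metric.measure_ball_pos _ _ one_pos).ne' measure_ball_lt_top.ne).ne'
  -- The Euclidean case settles this: a zero factor would give the unit ball measure zero.
  have hc0 : c ≠ 0 := by
    rintro rfl
    rw [zero_mul] at hE
    exact hb hE
  rw [finslerAreaIntegrand, hc (F x) h1 h2 h3, hE, mul_div_assoc, mul_div_mul_left _ _ hc0,
    div_eq_mul_inv]

end Hyperplane

/-! ### Comparing `rho` with operator norms -/

section Rho

variable {n k : ℕ} {g : EuclideanSpace ℝ (Fin n) → ℝ}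

lemma rho_nonneg (k : ℕ) (g : EuclideanSpace ℝ (Fin n) → ℝ) : 0 ≤ rho k g := by
  refine Real.sSup_nonneg ?_
  rintro r ⟨ξ, -, j, -, σ, rfl⟩
  exact abs_nonneg _

lemma abs_iteratedFDeriv_single_le (j : ℕ) (g : EuclideanSpace ℝ (Fin n) → ℝ)
    (ξ : EuclideanSpace ℝ (Fin n)) (σ : Fin j → Fin n) :
    |iteratedFDeriv ℝ j g ξ (fun i => EuclideanSpace.single (σ i) (1 : ℝ))| ≤
      ‖iteratedFDeriv ℝ j g ξ‖ := by
  refine ((iteratedFDeriv ℝ j g ξ).le_opNorm _).trans (le_of_eq ?_)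
  simp

lemma rho_le {B : ℝ} (hB : 0 ≤ B)
    (h : ∀ ξ, ‖ξ‖ = 1 → ∀ j ≤ k, ‖iteratedFDeriv ℝ j g ξ‖ ≤ B) : rho k g ≤ B := by
  refine Real.sSup_le ?_ hB
  rintro r ⟨ξ, hξ, j, hj, σ, rfl⟩
  exact (abs_iteratedFDeriv_single_le j g ξ σ).trans (h ξ (mem_sphere_zero_iff_norm.1 hξ) j hj)

lemma abs_iteratedFDeriv_single_le_rho (hg : ContDiffOn ℝ k g {0}ᶜ)
    {ξ : EuclideanSpace ℝ (Fin n)} (hξ : ‖ξ‖ = 1) {j : ℕ} (hj : j ≤ k) (σ : Fin j → Fin n) :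
    |iteratedFDeriv ℝ j g ξ (fun i => EuclideanSpace.single (σ i) (1 : ℝ))| ≤ rho k g := by
  -- The supremum dominates its members only if the set is bounded above; this comes from continuity
  -- of the derivatives on the compact sphere.
  have hb : ∀ i : ℕ, ∃ B : ℝ, i ≤ k → ∀ ξ ∈ Metric.sphere (0 : EuclideanSpace ℝ (Fin n)) 1,
      ‖iteratedFDeriv ℝ i g ξ‖ ≤ B := fun i => by
    by_cases hi : i ≤ k
    · have hc : ContinuousOn (iteratedFDeriv ℝ i g) {0}ᶜ :=
        (hg.continuousOn_iteratedFDerivWithin (by exact_mod_cast hi)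
          isOpen_compl_singleton.uniqueDiffOn).congr
          (iteratedFDerivWithin_of_isOpen i isOpen_compl_singleton).symm
      obtain ⟨B, hB⟩ := (isCompact_sphere (0 : EuclideanSpace ℝ (Fin n)) 1).exists_bound_of_continuousOn
        (hc.mono fun y hy => ne_zero_of_mem_unit_sphere ⟨y, hy⟩)
      exact ⟨B, fun _ => hB⟩
    · exact ⟨0, fun h => absurd h hi⟩
  choose B hB using hb
  refine le_csSup ⟨∑ i ∈ Finset.range (k + 1), |B i|, ?_⟩
    ⟨ξ, mem_sphere_zero_iff_norm.2 hξ, j, hj, σ, rfl⟩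
  rintro r ⟨ξ, hξ, i, hi, σ, rfl⟩
  refine (abs_iteratedFDeriv_single_le i g ξ σ).trans (((hB i hi ξ hξ).trans (le_abs_self _)).trans ?_)
  exact Finset.single_le_sum (f := fun i => |B i|) (fun i _ => abs_nonneg _)
    (Finset.mem_range.2 (by omega))

/-- Expanding every argument in the standard basis gives `n ^ j` terms, each a partial derivative
with coefficient at most `∏ ‖v i‖`. -/
lemma norm_iteratedFDeriv_le_rho (hn : 1 ≤ n) (hg : ContDiffOn ℝ k g {0}ᶜ)
    {ξ : EuclideanSpace ℝ (Fin n)} (hξ : ‖ξ‖ = 1) {j : ℕ} (hj : j ≤ k) :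
    ‖iteratedFDeriv ℝ j g ξ‖ ≤ (n : ℝ) ^ k * rho k g := by
  have hρ := rho_nonneg k g
  have hn' : (1 : ℝ) ≤ n := by exact_mod_cast hn
  have key : ‖iteratedFDeriv ℝ j g ξ‖ ≤ (n : ℝ) ^ j * rho k g := by
    refine ContinuousMultilinearMap.opNorm_le_bound (by positivity) fun v => ?_
    have hv : v = fun i => ∑ l, v i l • EuclideanSpace.single l (1 : ℝ) := by
      funext i
      ext a
      simp [Pi.single_apply]
    conv_lhs => rw [hv]
    rw [ContinuousMultilinearMap.map_sum]
    refine (norm_sum_le _ _).trans ?_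
    calc _ ≤ ∑ r : Fin j → Fin n, (∏ i, ‖v i‖) * rho k g := by
          refine Finset.sum_le_sum fun r _ => ?_
          rw [ContinuousMultilinearMap.map_smul_univ, norm_smul, norm_prod]
          refine mul_le_mul (Finset.prod_le_prod (fun i _ => norm_nonneg _)
            fun i _ => PiLp.norm_apply_le (v i) (r i))
            (abs_iteratedFDeriv_single_le_rho hg hξ hj r) (norm_nonneg _)
            (Finset.prod_nonneg fun i _ => norm_nonneg _)
      _ = _ := by
          rw [Finset.sum_const, Finset.card_univ, Fintype.card_fun, Fintype.card_fin,
            Fintype.card_fin, nsmul_eq_mul]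
          push_cast
          ring
  refine key.trans ?_
  gcongr

end Rho

/-! ### The graded estimate for the area integrand -/

section Estimate

variable {m : ℕ}

local notation "𝔼" n => EuclideanSpace ℝ (Fin n)

lemma isOpen_halfSpace (ξ : 𝔼 (m + 1)) : IsOpen {Z : 𝔼 (m + 1) | 0 < inner ℝ ξ Z} :=
  isOpen_lt continuous_const (by fun_prop)

lemma mem_halfSpace_self {ξ : 𝔼 (m + 1)} (h1 : ‖ξ‖ = 1) :
    ξ ∈ {Z : 𝔼 (m + 1) | 0 < inner ℝ ξ Z} := by
  simp [h1]

lemma contDiffOn_tilt_integrand {k : ℕ} {ξ : 𝔼 (m + 1)} (hξ : ξ ≠ 0) {G : (𝔼 (m + 1)) → ℝ}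
    (hG : ContDiffOn ℝ k G {0}ᶜ) (hpos : ∀ y, y ≠ 0 → 0 < G y) :
    ContDiffOn ℝ k (fun q : (𝔼 (m + 1)) × (𝔼 m) => ((G (tilt hξ q.2 q.1))⁻¹) ^ m)
      ({Z : 𝔼 (m + 1) | 0 < inner ℝ ξ Z} ×ˢ {0}ᶜ) := by
  have hmaps : MapsTo (fun q : (𝔼 (m + 1)) × (𝔼 m) => tilt hξ q.2 q.1)
      ({Z : 𝔼 (m + 1) | 0 < inner ℝ ξ Z} ×ˢ {0}ᶜ) {0}ᶜ :=
    fun q hq => tilt_ne_zero hξ hq.2 hq.1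
  have htilt : ContDiff ℝ k (fun q : (𝔼 (m + 1)) × (𝔼 m) => tilt hξ q.2 q.1) := by
    simp only [tilt_apply]
    have hP : ContDiff ℝ k (fun q : (𝔼 (m + 1)) × (𝔼 m) => hyperplaneParam hξ q.2) :=
      (hyperplaneParam hξ).contDiff.comp contDiff_snd
    exact ((contDiff_const.inner ℝ contDiff_fst).smul hP).sub
      ((hP.inner ℝ contDiff_fst).smul contDiff_const)
  exact ((hG.comp htilt.contDiffOn hmaps).inv fun q hq => (hpos _ (hmaps hq)).ne').pow m

lemma continuous_tilt_integrand {ξ : 𝔼 (m + 1)} (hξ : ξ ≠ 0) {G : (𝔼 (m + 1)) → ℝ}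
    (hG : ContinuousOn G {0}ᶜ) (hpos : ∀ y, y ≠ 0 → 0 < G y) {Z : 𝔼 (m + 1)}
    (hZ : 0 < inner ℝ ξ Z) :
    Continuous fun θ : Metric.sphere (0 : 𝔼 m) 1 => ((G (tilt hξ θ Z))⁻¹) ^ m :=
  (contDiffOn_tilt_integrand (k := 0) hξ (contDiffOn_zero.2 hG) hpos).continuousOn.comp_continuous
    (f := fun θ : Metric.sphere (0 : 𝔼 m) 1 => (Z, (θ : 𝔼 m))) (by fun_prop)
    fun θ => ⟨hZ, ne_zero_of_mem_unit_sphere θ⟩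

lemma integrable_tilt_integrand {ξ : 𝔼 (m + 1)} (hξ : ξ ≠ 0) {G : (𝔼 (m + 1)) → ℝ}
    (hG : ContinuousOn G {0}ᶜ) (hpos : ∀ y, y ≠ 0 → 0 < G y) {Z : 𝔼 (m + 1)}
    (hZ : 0 < inner ℝ ξ Z) :
    Integrable (fun θ : Metric.sphere (0 : 𝔼 m) 1 => ((G (tilt hξ θ Z))⁻¹) ^ m)
      (volume : Measure (𝔼 m)).toSphere :=
  (continuous_tilt_integrand hξ hG hpos hZ).integrable_of_hasCompactSupport
    (HasCompactSupport.of_compactSpace _)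

lemma tiltIntegral_pos (hm : 1 ≤ m) {ξ : 𝔼 (m + 1)} (hξ : ξ ≠ 0) {G : (𝔼 (m + 1)) → ℝ}
    (hG : ContinuousOn G {0}ᶜ) (hpos : ∀ y, y ≠ 0 → 0 < G y) {Z : 𝔼 (m + 1)}
    (hZ : 0 < inner ℝ ξ Z) : 0 < tiltIntegral hξ G Z := by
  have h0 : ∀ θ : Metric.sphere (0 : 𝔼 m) 1, 0 < ((G (tilt hξ θ Z))⁻¹) ^ m := fun θ =>
    pow_pos (inv_pos.2 (hpos _ (tilt_ne_zero hξ (ne_zero_of_mem_unit_sphere θ) hZ))) m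
  refine (integral_pos_iff_support_of_nonneg (fun θ => (h0 θ).le)
    (integrable_tilt_integrand hξ hG hpos hZ)).2 ?_
  rw [show Function.support _ = univ from eq_univ_of_forall fun θ => (h0 θ).ne']
  exact (ENNReal.toReal_pos_iff.1 (toSphere_real_pos hm)).1

/-- This keeps `J_F` away from zero at `ξ`, which is what the graded bound for `1 / J_F` requires.
-/
lemma le_tiltIntegral_self {ξ : 𝔼 (m + 1)} (hξ : ξ ≠ 0) (h1 : ‖ξ‖ = 1)
    {G : (𝔼 (m + 1)) → ℝ} (hG : ContinuousOn G {0}ᶜ) (hpos : ∀ y, y ≠ 0 → 0 < G y) {b : ℝ}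
    (hb : ∀ y, ‖y‖ = 1 → G y ≤ b) :
    (b⁻¹) ^ m * (volume : Measure (𝔼 m)).toSphere.real univ ≤ tiltIntegral hξ G ξ := by
  rw [mul_comm, ← smul_eq_mul, ← integral_const]
  refine integral_mono (integrable_const _)
    (integrable_tilt_integrand hξ hG hpos (mem_halfSpace_self h1)) fun θ => ?_
  simp only [tilt_self hξ h1]
  have hθ : ‖hyperplaneParam hξ θ‖ = 1 := by
    rw [LinearIsometry.norm_map]; exact mem_sphere_zero_iff_norm.1 θ.2
  have hp := hpos (hyperplaneParam hξ θ) (norm_pos_iff.1 (by rw [hθ]; exact one_pos))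
  have hle := hb _ hθ
  have hbp : 0 < b := hp.trans_le hle
  gcongr

lemma hasGradedBound_comp_tilt {k : ℕ} {ξ : 𝔼 (m + 1)} (hξ : ξ ≠ 0) (h1 : ‖ξ‖ = 1)
    {G : (𝔼 (m + 1)) → ℝ} (hG : ContDiffOn ℝ k G {0}ᶜ) {R A : ℝ} (hR : 1 ≤ R)
    (hA : ∀ y, ‖y‖ = 1 → ∀ j ≤ k, ‖iteratedFDeriv ℝ j G y‖ ≤ A * R ^ j)
    (θ : Metric.sphere (0 : 𝔼 m) 1) :
    HasGradedBound k {Z | 0 < inner ℝ ξ Z} ξ R (2 ^ k * A) (fun Z => G (tilt hξ θ Z)) := by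
  have hθ1 : ‖(θ : 𝔼 m)‖ = 1 := mem_sphere_zero_iff_norm.1 θ.2
  refine HasGradedBound.of_comp_linear isOpen_compl_singleton hG (tilt hξ θ) one_le_two
    ((norm_tilt_le hξ h1 _).trans (by rw [hθ1, mul_one])) (isOpen_halfSpace ξ)
    (mem_halfSpace_self h1)
    (fun Z hZ => tilt_ne_zero hξ (ne_zero_of_mem_unit_sphere θ) hZ) (zero_le_one.trans hR)
    (hA _ ?_)
  rw [tilt_self hξ h1, LinearIsometry.norm_map, hθ1]

lemma hasGradedBound_inv_comp_tilt {k : ℕ} {ξ : 𝔼 (m + 1)} (hξ : ξ ≠ 0) (h1 : ‖ξ‖ = 1)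
    {G : (𝔼 (m + 1)) → ℝ} (hG : ContDiffOn ℝ k G {0}ᶜ) (hpos : ∀ y, y ≠ 0 → 0 < G y)
    {R A : ℝ} (hR : 1 ≤ R)
    (hA : ∀ y, ‖y‖ = 1 → ∀ j ≤ k, ‖iteratedFDeriv ℝ j G y‖ ≤ A * R ^ j)
    {c : ℝ} (hc : 0 < c) (hcG : ∀ y, ‖y‖ = 1 → c ≤ G y) (θ : Metric.sphere (0 : 𝔼 m) 1) :
    HasGradedBound k {Z | 0 < inner ℝ ξ Z} ξ R (HasGradedBound.invBound k c (2 ^ k * A))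
      (fun Z => (G (tilt hξ θ Z))⁻¹) := by
  refine (hasGradedBound_comp_tilt hξ h1 hG hR hA θ).inv (isOpen_halfSpace ξ)
    (mem_halfSpace_self h1) hR
    (fun Z hZ => (hpos _ (tilt_ne_zero hξ (ne_zero_of_mem_unit_sphere θ) hZ)).ne') hc ?_
  refine (hcG _ ?_).trans (le_abs_self _)
  rw [tilt_self hξ h1, LinearIsometry.norm_map]
  exact mem_sphere_zero_iff_norm.1 θ.2

lemma contDiffOn_norm_compl_zero (k : ℕ) :
    ContDiffOn ℝ k (fun y : 𝔼 (m + 1) => ‖y‖) {0}ᶜ :=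
  fun _ hy => (contDiffAt_norm ℝ hy).contDiffWithinAt

/-- The central estimate: `|·| - A^F` is controlled by `|·| - F`, with one power of `R` for each
derivative. -/
lemma exists_hasGradedBound_norm_sub_finslerAreaIntegrand (k : ℕ) (hm : 1 ≤ m) {c b : ℝ}
    (hc : 0 < c) (hb : 0 < b) (A : ℝ) :
    ∃ Q : ℝ, 0 ≤ Q ∧ ∀ (F : (𝔼 (m + 1)) → (𝔼 (m + 1)) → ℝ) (x : 𝔼 (m + 1)),
      ContDiffOn ℝ k (F x) {0}ᶜ → (∀ y, y ≠ 0 → 0 < F x y) →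
      (∀ (t : ℝ) (y : 𝔼 (m + 1)), 0 < t → F x (t • y) = t * F x y) →
      (∀ y, ‖y‖ = 1 → c ≤ F x y) → (∀ y, ‖y‖ = 1 → F x y ≤ b) →
      ∀ R D : ℝ, 1 ≤ R →
      (∀ y, ‖y‖ = 1 → ∀ j ≤ k, ‖iteratedFDeriv ℝ j (F x) y‖ ≤ A * R ^ j) →
      (∀ y, ‖y‖ = 1 → ∀ j ≤ k, ‖iteratedFDeriv ℝ j (fun y => ‖y‖ - F x y) y‖ ≤ D * R ^ j) →
      ∀ ξ : 𝔼 (m + 1), ‖ξ‖ = 1 → HasGradedBound k {Z | 0 < inner ℝ ξ Z} ξ R (Q * D)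
        (fun Z => ‖Z‖ - finslerAreaIntegrand F x Z) := by
  set AE : ℝ := ((m + 1 : ℕ) : ℝ) ^ k * rho k (fun y : 𝔼 (m + 1) => ‖y‖) with hAE
  have hAE0 : 0 ≤ AE := mul_nonneg (by positivity) (rho_nonneg _ _)
  set Bf := HasGradedBound.invBound k c (2 ^ k * A) with hBf
  set Be := HasGradedBound.invBound k 1 (2 ^ k * AE) with hBe
  set s := (volume : Measure (𝔼 m)).toSphere.real univ with hs
  have hs0 : 0 < s := toSphere_real_pos hm
  set BJ := HasGradedBound.invBound k ((b⁻¹) ^ m * s) ((2 ^ k * Bf) ^ m * s) with hBJ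
  have inv_nonneg : ∀ a C, 0 ≤ HasGradedBound.invBound k a C := fun a C => by
    unfold HasGradedBound.invBound; positivity
  have hBf0 : 0 ≤ Bf := inv_nonneg _ _
  have hBe0 : 0 ≤ Be := inv_nonneg _ _
  have hBJ0 : 0 ≤ BJ := inv_nonneg _ _
  obtain ⟨Q, hQ, hpow⟩ := HasGradedBound.exists_pow_sub k Bf Be m
  -- One `2 ^ k` comes from composing with the tilt, of norm at most 2; the other displayed ones
  -- come from the Leibniz rule.
  refine ⟨2 ^ k * (AE * (2 ^ k * (Q * (2 ^ k * (2 ^ k * (2 ^ k * (Bf * Be)))) * s * BJ))),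
    by positivity, ?_⟩
  intro F x hF hpos hhom hcF hbF R D hR hA hD ξ h1
  have hR0 : 0 ≤ R := zero_le_one.trans hR
  have hξ : ξ ≠ 0 := norm_pos_iff.1 (by rw [h1]; exact one_pos)
  have hU := isOpen_halfSpace ξ
  have hp := mem_halfSpace_self h1
  set U : Set (𝔼 (m + 1)) := {Z | 0 < inner ℝ ξ Z} with hUdef
  have hUne : ∀ Z ∈ U, Z ≠ 0 := by
    rintro Z hZ rfl
    simp [hUdef] at hZ
  have hE := contDiffOn_norm_compl_zero (m := m) k
  have hEpos : ∀ y : 𝔼 (m + 1), y ≠ 0 → 0 < ‖y‖ := fun y hy => norm_pos_iff.2 hy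
  have hEA : ∀ y : 𝔼 (m + 1), ‖y‖ = 1 → ∀ j ≤ k,
      ‖iteratedFDeriv ℝ j (fun y : 𝔼 (m + 1) => ‖y‖) y‖ ≤ AE * R ^ j := fun y hy j hj =>
    (norm_iteratedFDeriv_le_rho (by omega) hE hy hj).trans
      (le_mul_of_one_le_right hAE0 (one_le_pow₀ hR))
  have hf := hasGradedBound_inv_comp_tilt hξ h1 hF hpos hR hA hc hcF
  have he := hasGradedBound_inv_comp_tilt hξ h1 hE hEpos hR hEA one_pos (fun _ hy => hy.ge)
  have hsub := hasGradedBound_comp_tilt hξ h1 (hE.sub hF) hR hD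
  have hdiff : ∀ θ : Metric.sphere (0 : 𝔼 m) 1, HasGradedBound k U ξ R
      (2 ^ k * (2 ^ k * D * (2 ^ k * (Bf * Be))))
      (fun Z => (F x (tilt hξ θ Z))⁻¹ - ‖tilt hξ θ Z‖⁻¹) := fun θ => by
    -- `1/F - 1/E = (E - F) · (1/F · 1/E)`, evaluated at the tilted point.
    refine ((hsub θ).mul ((hf θ).mul (he θ) hU hp hR0) hU hp hR0).congr (fun Z hZ => ?_) hp
    have h0 := tilt_ne_zero hξ (ne_zero_of_mem_unit_sphere θ) hZ
    have h2 := (hpos _ h0).ne'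
    have h3 := (hEpos _ h0).ne'
    field_simp
  have hdiffpow := fun θ => hpow hU hp hR0 (hf θ) (he θ) (hdiff θ)
  have hO : IsOpen (U ×ˢ ({0}ᶜ : Set (𝔼 m))) := hU.prod isOpen_compl_singleton
  have hUO : ∀ Z ∈ U, ∀ θ : Metric.sphere (0 : 𝔼 m) 1,
      (Z, (θ : 𝔼 m)) ∈ U ×ˢ ({0}ᶜ : Set (𝔼 m)) :=
    fun Z hZ θ => ⟨hZ, ne_zero_of_mem_unit_sphere θ⟩
  have hgF := contDiffOn_tilt_integrand hξ hF hpos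
  have hgE := contDiffOn_tilt_integrand hξ hE hEpos
  have hJF : HasGradedBound k U ξ R ((2 ^ k * Bf) ^ m * s) (tiltIntegral hξ (F x)) :=
    HasGradedBound.integral (μ := (volume : Measure (𝔼 m)).toSphere) hO hgF hU hp
      continuous_subtype_val hUO fun θ => (hf θ).pow hU hp hR0 m
  have hJsub : HasGradedBound k U ξ R (Q * (2 ^ k * (2 ^ k * D * (2 ^ k * (Bf * Be)))) * s)
      (fun Z => tiltIntegral hξ (F x) Z - tiltIntegral hξ (fun y => ‖y‖) Z) := by
    refine (HasGradedBound.integral (μ := (volume : Measure (𝔼 m)).toSphere) hO (hgF.sub hgE) hU hp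
      continuous_subtype_val hUO hdiffpow).congr (fun Z hZ => ?_) hp
    exact (integral_sub (integrable_tilt_integrand hξ hF.continuousOn hpos hZ)
      (integrable_tilt_integrand hξ hE.continuousOn hEpos hZ)).symm
  have hJpos : ∀ Z ∈ U, tiltIntegral hξ (F x) Z ≠ 0 := fun Z hZ =>
    (tiltIntegral_pos hm hξ hF.continuousOn hpos hZ).ne'
  have hJinv := hJF.inv hU hp hR hJpos (a := (b⁻¹) ^ m * s) (by positivity)
    ((le_tiltIntegral_self hξ h1 hF.continuousOn hpos hbF).trans (le_abs_self _))
  have hEU : HasGradedBound k U ξ R AE (fun Z => ‖Z‖) :=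
    ⟨hE.mono hUne, fun j hj => by
      rw [iteratedFDerivWithin_of_isOpen _ hU hp]; exact hEA ξ h1 j hj⟩
  -- This is `|Z| - A^F = |Z| (J_F - J_E) J_F⁻¹`.
  refine ((hEU.mul (hJsub.mul hJinv hU hp hR0) hU hp hR0).congr (fun Z hZ => ?_) hp).mono hR0
    (le_of_eq (by ring))
  rw [finslerAreaIntegrand_eq hξ hm hZ hF.continuousOn hpos hhom]
  have := hJpos Z hZ
  field_simp

end Estimate

/-! ### Choice of constants and conclusion -/

theorem lemma3p9 (m k : ℕ) (hm : 1 ≤ m) :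
    ∃ C : ℝ → ℝ → ℝ,
      ∀ (F : EuclideanSpace ℝ (Fin (m + 1)) → EuclideanSpace ℝ (Fin (m + 1)) → ℝ)
        (x : EuclideanSpace ℝ (Fin (m + 1))),
        ContDiffOn ℝ k (F x) {0}ᶜ →
        (∀ y, y ≠ 0 → 0 < F x y) →
        (∀ (t : ℝ) (y : EuclideanSpace ℝ (Fin (m + 1))), 0 < t → F x (t • y) = t * F x y) →
        ∀ c₂ : ℝ, (∀ y, F x y ≤ c₂ * ‖y‖) →
          ContDiffOn ℝ k (finslerAreaIntegrand F x) {0}ᶜ ∧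
          rho k (fun Z => ‖Z‖ - finslerAreaIntegrand F x Z) ≤
            C (c₂ ^ m) (⨅ ξ : Metric.sphere (0 : EuclideanSpace ℝ (Fin (m + 1))) 1, F x ξ) *
              rho k (fun y => ‖y‖ - F x y) *
              rhoHat k (F x) ^ (2 * (k : ℤ) ^ 2 + (m : ℤ) * (k : ℤ) - 1) := by
  let N : ℝ := ((m + 1 : ℕ) : ℝ) ^ k
  have hN : 0 ≤ N := by positivity
  have hex : ∀ M c : ℝ, ∃ Q : ℝ, 0 < c → 0 ≤ Q ∧ _ := fun M c => by
    by_cases hc : 0 < c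
    · obtain ⟨Q, hQ⟩ := exists_hasGradedBound_norm_sub_finslerAreaIntegrand k hm hc
        (zero_lt_one.trans_le (le_max_left 1 M)) (max 1 M + N)
      exact ⟨Q, fun _ => hQ⟩
    · exact ⟨0, fun h => absurd h hc⟩
  choose Q hQ using hex
  refine ⟨fun M c => Q M c * N * max 1 M, fun F x hF hpos hhom c₂ hc₂ => ?_⟩
  set c₁ := ⨅ ξ : Metric.sphere (0 : EuclideanSpace ℝ (Fin (m + 1))) 1, F x ξ with hc₁
  have hne : ∀ y : EuclideanSpace ℝ (Fin (m + 1)), ‖y‖ = 1 → y ≠ 0 :=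
    fun y hy => norm_pos_iff.1 (by rw [hy]; exact one_pos)
  have hcont : Continuous fun ξ : Metric.sphere (0 : EuclideanSpace ℝ (Fin (m + 1))) 1 => F x ξ :=
    hF.continuousOn.comp_continuous continuous_subtype_val
      fun ξ => ne_zero_of_mem_unit_sphere ξ
  have hcle : ∀ y, ‖y‖ = 1 → c₁ ≤ F x y := fun y hy =>
    ciInf_le (f := fun ξ : Metric.sphere (0 : EuclideanSpace ℝ (Fin (m + 1))) 1 => F x ξ)
      ⟨0, by rintro _ ⟨ξ, rfl⟩; exact (hpos _ (ne_zero_of_mem_unit_sphere ξ)).le⟩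
      ⟨y, mem_sphere_zero_iff_norm.2 hy⟩
  have hsne : Nonempty (Metric.sphere (0 : EuclideanSpace ℝ (Fin (m + 1))) 1) :=
    (NormedSpace.sphere_nonempty.2 zero_le_one).to_subtype
  have hc₁pos : 0 < c₁ := by
    obtain ⟨ξ, hξ⟩ := hcont.exists_forall_le_of_hasCompactSupport
      (HasCompactSupport.of_compactSpace _)
    exact (hpos _ (ne_zero_of_mem_unit_sphere ξ)).trans_le (le_ciInf hξ)
  have hble : ∀ y, ‖y‖ = 1 → F x y ≤ max 1 (c₂ ^ m) := fun y hy => by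
    have h := hc₂ y
    rw [hy, mul_one] at h
    -- Only `c₂ ^ m` may enter the constant: either `c₂ ≤ 1`, or `c₂ ≤ c₂ ^ m` because `m ≥ 1`.
    rcases le_total c₂ 1 with h1 | h1
    · exact (h.trans h1).trans (le_max_left _ _)
    · exact (h.trans (le_self_pow₀ h1 (by omega))).trans (le_max_right _ _)
  set b := max 1 (c₂ ^ m) with hb
  have hb1 : 1 ≤ b := le_max_left _ _
  set R := rhoHat k (F x) with hR
  have hR1 : 1 ≤ R := le_max_left _ _
  have hρ := rho_nonneg k (fun y => ‖y‖ - F x y)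
  obtain ⟨hQ0, hQ'⟩ := hQ (c₂ ^ m) c₁ hc₁pos
  -- Order zero offers no factor `R`, so `F` is bounded there by `b`; for `j ≥ 1`, `rho k (F x) ≤ R
  -- ≤ R ^ j`.
  have hA : ∀ y, ‖y‖ = 1 → ∀ j ≤ k, ‖iteratedFDeriv ℝ j (F x) y‖ ≤ (b + N) * R ^ j := by
    intro y hy j hj
    rcases Nat.eq_zero_or_pos j with rfl | hj0
    · rw [norm_iteratedFDeriv_zero, pow_zero, mul_one, Real.norm_of_nonneg (hpos y (hne y hy)).le]
      linarith [hble y hy]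
    · refine (norm_iteratedFDeriv_le_rho (by omega) hF hy hj).trans ?_
      have h1 : rho k (F x) ≤ R ^ j := (le_max_right _ _).trans (le_self_pow₀ hR1 (by omega))
      have h2 : N * rho k (F x) ≤ N * R ^ j := by gcongr
      have h3 : 0 ≤ b * R ^ j := by positivity
      linarith
  have hsm := (contDiffOn_norm_compl_zero (m := m) k).sub hF
  have hD : ∀ y, ‖y‖ = 1 → ∀ j ≤ k, ‖iteratedFDeriv ℝ j (fun y => ‖y‖ - F x y) y‖ ≤
      N * rho k (fun y => ‖y‖ - F x y) * R ^ j := fun y hy j hj =>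
    (norm_iteratedFDeriv_le_rho (by omega) hsm hy hj).trans
      (le_mul_of_one_le_right (by positivity) (one_le_pow₀ hR1))
  have key := hQ' F x hF hpos hhom hcle hble R _ hR1 hA hD
  -- The factor `b` matters only for `k = 0`, where the claim is `R ≤ b`; for `k ≥ 1` the exponent
  -- is at least `k`.
  have hRpow : R ^ k ≤ b * R ^ (2 * (k : ℤ) ^ 2 + (m : ℤ) * (k : ℤ) - 1) := by
    rcases Nat.eq_zero_or_pos k with hk | hk
    · have hRb : R ≤ b := by
        refine max_le hb1 (rho_le (by positivity) fun y hy j hj => ?_)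
        obtain rfl : j = 0 := by omega
        rw [norm_iteratedFDeriv_zero, Real.norm_of_nonneg (hpos y (hne y hy)).le]
        exact hble y hy
      rw [hk]
      simp only [pow_zero, Nat.cast_zero, mul_zero, ne_eq, OfNat.ofNat_ne_zero, not_false_eq_true,
        zero_pow, add_zero, zero_sub, zpow_neg, zpow_one]
      rw [← div_eq_mul_inv, le_div_iff₀ (by positivity), one_mul]
      exact hRb
    · have h1 : R ^ k ≤ R ^ (2 * (k : ℤ) ^ 2 + (m : ℤ) * (k : ℤ) - 1) := by
        rw [← zpow_natCast]
        refine zpow_le_zpow_right₀ hR1 ?_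
        have hk' : (1 : ℤ) ≤ k := by exact_mod_cast hk
        have hm' : (1 : ℤ) ≤ m := by exact_mod_cast hm
        nlinarith
      exact h1.trans (le_mul_of_one_le_left (by positivity) hb1)
  refine ⟨fun Z hZ => ?_, rho_le (by positivity) fun ξ hξ j hj => ?_⟩
  -- The half-space of `Z / ‖Z‖` is a neighbourhood of `Z`, and `A^F` is the norm minus the function
  -- controlled there.
  · have hn : 0 < ‖Z‖ := norm_pos_iff.2 hZ
    have hξ : ‖‖Z‖⁻¹ • Z‖ = 1 := by
      rw [norm_smul, norm_inv, norm_norm, inv_mul_cancel₀ hn.ne']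
    have hU := isOpen_halfSpace (‖Z‖⁻¹ • Z)
    have hZU : Z ∈ {Y | 0 < inner ℝ (‖Z‖⁻¹ • Z) Y} := by
      simp only [mem_ofPred_eq, inner_smul_left, real_inner_self_eq_norm_sq]
      simp
      positivity
    have h2 := (key _ hξ).1.contDiffAt (hU.mem_nhds hZU)
    have h3 := ((contDiffAt_norm ℝ hZ).sub h2).contDiffWithinAt (s := {0}ᶜ)
    simpa using h3
  · have h2 := (key ξ hξ).2 j hj
    rw [iteratedFDerivWithin_of_isOpen _ (isOpen_halfSpace ξ) (mem_halfSpace_self hξ)] at h2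
    refine h2.trans ?_
    calc _ ≤ Q (c₂ ^ m) c₁ * (N * rho k (fun y => ‖y‖ - F x y)) * R ^ k := by
          gcongr
      _ ≤ Q (c₂ ^ m) c₁ * (N * rho k (fun y => ‖y‖ - F x y)) *
          (b * R ^ (2 * (k : ℤ) ^ 2 + (m : ℤ) * (k : ℤ) - 1)) := by gcongr
      _ = _ := by ring
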